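/- Let $p \ge 1$, let $O = (o_1, \ldots, o_p)$ be an orthogonal $p \times p$ matrix with columns $o_i$, and let $\Lambda = \sigma\,\mathrm{diag}(\lambda, 1, \ldots, 1)$ be a $p \times p$ matrix with $\sigma > 0$ and $\lambda > 1$. Let $P$ be a probability distribution on $\mathbb{R}^p$ in the elliptical family $\mathcal{E}(O, \Lambda)$, that is, $X \sim P$ has a representation $X = O \Lambda Z$ with a random vector $Z$ in $\mathbb{R}^p$ such that 1. $Z$ is spherical: $VZ$ and $Z$ have the same distribution for every orthogonal $p \times p$ matrix $V$; 2. $R := \|Z\|$ has a density $f_R : (0, \infty) \to (0, \infty)$ with respect to the Lebesgue measure; 3. $r \mapsto f_R(r)/r^{p-1}$ is strictly decreasing on $(0, \infty)$; 4. $\mathrm{E}(R) < \infty$. Here $\|\cdot\|$ is the Euclidean norm. Define $$ f_P(v) = \mathrm{E}\left( \|X - v\| \, \|X + v\| - \|X\|^2 \right), \qquad v \in \mathbb{R}^p, $$ let $S_P = \mathrm{E}\left( X X^\top / \|X\|^2 \right)$ be the spatial sign covariance matrix of $P$, and let $\phi_1(S_P)$ be its largest eigenvalue. (i) If $\phi_1(S_P)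 > 1/2$, then there exists $\psi > 0$ such that the set of global minimizers of $f_P$ over $\mathbb{R}^p$ is exactly $\{ \psi o_1, -\psi o_1 \}$. (ii) If $\phi_1(S_P) \le 1/2$, then $v = 0$ is the unique global minimizer of $f_P$ over $\mathbb{R}^p$. -/

import Mathlib

noncomputable section

namespace EllipticalPCA

/-- `ℝᵖ` with its Euclidean norm. -/
abbrev E (p : ℕ) : Type := EuclideanSpace ℝ (Fin p)

/-- The map `x ↦ A x` on `ℝᵖ` given by a `p × p` matrix. -/
def act {p : ℕ} (A : Matrix (Fin p) (Fin p) ℝ) (x : E p) : E p :=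
  Matrix.toEuclideanCLM (n := Fin p) (𝕜 := ℝ) A x

lemma act_apply {p : ℕ} (A : Matrix (Fin p) (Fin p) ℝ) (x : E p) (i : Fin p) :
    act A x i = ∑ j, A i j * x j := rfl

/-- The matrices `σ diag(l, 1, …, 1)` with `σ > 0` and `l > 1`. -/
def D1 (p : ℕ) [NeZero p] : Set (Matrix (Fin p) (Fin p) ℝ) :=
  {L | ∃ s l : ℝ, 0 < s ∧ 1 < l ∧
    L = s • Matrix.diagonal (fun i : Fin p => if i = 0 then l else 1)}

/-- The law `Q` of a random vector `Z` is spherical: `V Z` and `Z` have the same law for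
every orthogonal matrix `V`. -/
def IsSpherical {p : ℕ} (Q : MeasureTheory.Measure (E p)) : Prop :=
  ∀ V ∈ Matrix.orthogonalGroup (Fin p) ℝ, Q.map (act V) = Q

/-- The conditions on the law `Q` of the generating vector `Z` of the elliptical family. -/
structure IsGenerator {p : ℕ} (Q : MeasureTheory.Measure (E p)) : Prop where
  isProbabilityMeasure : MeasureTheory.IsProbabilityMeasure Q
  isSpherical : IsSpherical Q
  /-- The radius `R = ‖Z‖` has a positive density `fR` on `(0, ∞)`, with `fR r / r ^ (p - 1)`
  strictly decreasing. -/
  exists_density : ∃ fR : ℝ → ℝ, Measurable fR ∧ (∀ r, 0 < r → 0 < fR r) ∧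
    Q.map (fun z => ‖z‖) =
      (MeasureTheory.volume.restrict (Set.Ioi (0 : ℝ))).withDensity
        (fun r => ENNReal.ofReal (fR r)) ∧
    StrictAntiOn (fun r => fR r / r ^ (p - 1)) (Set.Ioi 0)
  /-- `E ‖Z‖` is finite. -/
  integrable_norm : MeasureTheory.Integrable (fun z : E p => ‖z‖) Q

/-- The elliptical family: the laws of `X = O L Z`, where the law of `Z` is a generator. -/
def ellipticalFamily {p : ℕ} (O L : Matrix (Fin p) (Fin p) ℝ) :
    Set (MeasureTheory.Measure (E p)) :=
  {P | ∃ Q : MeasureTheory.Measure (E p), IsGenerator Q ∧ P = Q.map (act (O * L))}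

/-- The objective function `f_P(v) = E (‖X - v‖ ‖X + v‖ - ‖X‖²)`, `X ∼ P`. -/
def objective {p : ℕ} (P : MeasureTheory.Measure (E p)) (v : E p) : ℝ :=
  ∫ x, (‖x - v‖ * ‖x + v‖ - ‖x‖ ^ 2) ∂P

/-- The integrand of `objective` is bounded, so that `objective` is a genuine expectation for
every probability measure. -/
lemma abs_objective_integrand_le {p : ℕ} (x v : E p) :
    |‖x - v‖ * ‖x + v‖ - ‖x‖ ^ 2| ≤ ‖v‖ ^ 2 := by
  have h1 := norm_sub_sq_real x v
  have h2 := norm_add_sq_real x v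
  have h3 : |inner ℝ (x - v) (x + v)| ≤ ‖x - v‖ * ‖x + v‖ := abs_real_inner_le_norm _ _
  have h4 : inner ℝ (x - v) (x + v) = ‖x‖ ^ 2 - ‖v‖ ^ 2 := by
    rw [inner_sub_left, inner_add_right, inner_add_right, real_inner_comm x v,
      real_inner_self_eq_norm_sq, real_inner_self_eq_norm_sq]
    ring
  rw [h4] at h3
  have h5 := le_abs_self (‖x‖ ^ 2 - ‖v‖ ^ 2)
  rw [abs_le]
  constructor
  · linarith
  · nlinarith [sq_nonneg (‖x - v‖ - ‖x + v‖)]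

lemma integrable_objective_integrand {p : ℕ} (P : MeasureTheory.Measure (E p))
    [MeasureTheory.IsProbabilityMeasure P] (v : E p) :
    MeasureTheory.Integrable (fun x : E p => ‖x - v‖ * ‖x + v‖ - ‖x‖ ^ 2) P := by
  refine MeasureTheory.Integrable.of_bound (C := ‖v‖ ^ 2)
    (Continuous.aestronglyMeasurable (by fun_prop)) ?_
  exact Filter.Eventually.of_forall fun x => abs_objective_integrand_le x v

/-- The set of global minimizers of a real function. -/
def minimizers {α : Type*} (f : α → ℝ) : Set α := {v | ∀ w, f v ≤ f w}

/-- The spatial sign covariance matrix `S_P = E (X Xᵀ / ‖X‖²)`, `X ∼ P`. -/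
def signCov {p : ℕ} (P : MeasureTheory.Measure (E p)) : Matrix (Fin p) (Fin p) ℝ :=
  Matrix.of fun i j => ∫ x, x i * x j / ‖x‖ ^ 2 ∂P

lemma signCov_isHermitian {p : ℕ} (P : MeasureTheory.Measure (E p)) :
    (signCov P).IsHermitian := by
  ext i j
  simp [signCov, mul_comm]

/-- The largest real eigenvalue of a matrix. -/
def leadingEigenvalue {p : ℕ} (A : Matrix (Fin p) (Fin p) ℝ) : ℝ := sSup (spectrum ℝ A)

/-- For a symmetric matrix the supremum in `leadingEigenvalue` is attained. -/
lemma isGreatest_leadingEigenvalue {p : ℕ} [NeZero p] {A : Matrix (Fin p) (Fin p) ℝ}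
    (hA : A.IsHermitian) : IsGreatest (spectrum ℝ A) (leadingEigenvalue A) := by
  have h : spectrum ℝ A = Set.range hA.eigenvalues := hA.spectrum_real_eq_range_eigenvalues
  have hf : (spectrum ℝ A).Finite := h ▸ Set.finite_range _
  have hn : (spectrum ℝ A).Nonempty := h ▸ Set.range_nonempty _
  exact ⟨hn.csSup_mem hf, fun x hx => le_csSup hf.bddAbove hx⟩

/-- The first column `o₁` of a matrix, as a vector of `ℝᵖ`. -/
def firstColumn {p : ℕ} [NeZero p] (O : Matrix (Fin p) (Fin p) ℝ) : E p :=
  WithLp.toLp 2 (fun i => O i 0)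

end EllipticalPCA

end

/-! Sphericity and the radial density give `Z` a Lebesgue density proportional to `fR r / r ^ (p -
1)` at `r = ‖z‖`, so `X = T Z` has a density `w` that is a strictly decreasing function of `‖T⁻¹
x‖`. On a sphere, `‖T⁻¹ x‖` decreases as `|⟪x, o₁⟫|` grows; hence `w` is strictly larger closer to
the line `ℝ o₁` (`exists_isConcentratedAlong`).

For `v` off this line, let `f` be the reflection exchanging `v` and `a = ‖v‖ o₁`. The difference of
the integrands at `v` and `a` is odd under `f` and has the sign of `w - w ∘ f`, so the objective is
strictly smaller at `a` (`IsConcentratedAlong.objective_lt`). All minimizers therefore lie on `ℝ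
o₁`.

Along a unit vector `u`, as a function of `t = ‖v‖²`, the objective is continuous and strictly
midpoint convex, vanishes at `0`, and has slope `1 - 2 uᵀ S_P u` at `0` and slope `1` at infinity.
If `φ₁ ≤ 1/2`, the slope at `0` along `o₁` is nonnegative and `0` is the only minimizer. If `φ₁ >
1/2`, the objective is negative somewhere along a leading eigenvector, hence also along `o₁` by the
comparison, and the profile has a unique minimizer `t > 0`. It is never needed that `o₁` is a
leading eigenvector. -/

namespace EllipticalPCA

open MeasureTheory Set Filter Topology

/-! ### Densities of isometry-invariant measures -/

section Radial

variable {F : Type*} [NormedAddCommGroup F] [InnerProductSpace ℝ F] [FiniteDimensional ℝ F]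
  [MeasurableSpace F] [BorelSpace F]

/-- Integration of a radial function in polar coordinates. -/
lemma lintegral_fun_norm_addHaar [Nontrivial F] (μ : Measure F) [μ.IsAddHaarMeasure]
    {f : ℝ → ENNReal} (hf : Measurable f) :
    ∫⁻ x, f ‖x‖ ∂μ = μ.toSphere univ *
      ∫⁻ r in Ioi (0 : ℝ), ENNReal.ofReal (r ^ (Module.finrank ℝ F - 1)) * f r := by
  calc ∫⁻ x, f ‖x‖ ∂μ = ∫⁻ x : ({(0)}ᶜ : Set F), f ‖x.1‖ ∂(μ.comap (↑)) := by
        rw [lintegral_subtype_comap (measurableSet_singleton _).compl fun x ↦ f (‖x‖),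
          restrict_compl_singleton]
    _ = ∫⁻ x, f x.2 ∂μ.toSphere.prod (.volumeIoiPow (Module.finrank ℝ F - 1)) := by
        simpa using μ.measurePreserving_homeomorphUnitSphereProd.lintegral_comp_emb
          (Homeomorph.measurableEmbedding _) (f ∘ Subtype.val ∘ Prod.snd)
    _ = μ.toSphere univ *
          ∫⁻ r : Ioi (0 : ℝ), f r ∂.volumeIoiPow (Module.finrank ℝ F - 1) := by
        have hm : Measurable fun x : Metric.sphere (0 : F) 1 × Ioi (0 : ℝ) => f x.2 :=
          hf.comp (measurable_subtype_coe.comp measurable_snd)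
        rw [lintegral_prod _ hm.aemeasurable]
        simp [mul_comm]
    _ = _ := by
        have hm : Measurable fun r : Ioi (0 : ℝ) => f r := hf.comp measurable_subtype_coe
        rw [Measure.volumeIoiPow, lintegral_withDensity_eq_lintegral_mul _ (by fun_prop) hm,
          ← lintegral_subtype_comap measurableSet_Ioi]
        rfl

/-- A measure which is invariant under isometries has a radial characteristic function. -/
lemma charFun_eq_of_norm_eq {Q : Measure F} (hQ : ∀ f : F ≃ₗᵢ[ℝ] F, Q.map f = Q) {ξ η : F}
    (h : ‖ξ‖ = ‖η‖) : charFun Q ξ = charFun Q η := by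
  have key : Submodule.reflection (ℝ ∙ (ξ - η))ᗮ ξ = η := Submodule.reflection_sub h
  set f := Submodule.reflection (ℝ ∙ (ξ - η))ᗮ
  have e : charFun (Q.map f) η = charFun Q ξ := by
    rw [charFun_apply, charFun_apply, integral_map (by fun_prop) (by fun_prop)]
    simp [← key]
  rw [← e, hQ f]

/-- The average over directions of the character `x ↦ exp (i t ⟪x, ·⟫)`. -/
noncomputable def sphericalKernel (t : ℝ) (x : F) : ℂ :=
  ∫ y in Metric.ball (0 : F) 1, Complex.exp ((inner ℝ x (t • ‖y‖⁻¹ • y) : ℝ) * Complex.I)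

lemma integrable_prod_character {Q : Measure F} [IsFiniteMeasure Q] (t : ℝ) :
    Integrable (fun z : F × F => Complex.exp ((inner ℝ z.1 (t • ‖z.2‖⁻¹ • z.2) : ℝ) * Complex.I))
      (Q.prod (volume.restrict (Metric.ball (0 : F) 1))) := by
  have : IsFiniteMeasure (volume.restrict (Metric.ball (0 : F) 1)) :=
    ⟨by simpa using measure_ball_lt_top⟩
  refine Integrable.of_bound (C := 1) (Measurable.aestronglyMeasurable (by fun_prop)) ?_
  exact Eventually.of_forall fun z => (Complex.norm_exp_ofReal_mul_I _).le

lemma stronglyMeasurable_sphericalKernel (t : ℝ) :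
    StronglyMeasurable (sphericalKernel t : F → ℂ) := by
  have : IsFiniteMeasure (volume.restrict (Metric.ball (0 : F) 1)) :=
    ⟨by simpa using measure_ball_lt_top⟩
  refine StronglyMeasurable.integral_prod_right (f := fun (x : F) (y : F) =>
    Complex.exp ((inner ℝ x (t • ‖y‖⁻¹ • y) : ℝ) * Complex.I)) ?_
  apply Measurable.stronglyMeasurable
  simp only [Function.uncurry_def]
  fun_prop

/-- The reflection exchanging `x` and `x'` preserves the ball and Lebesgue measure, so it is a
change of variables between the two integrals. -/
lemma sphericalKernel_eq_of_norm_eq (t : ℝ) {x x' : F} (h : ‖x‖ = ‖x'‖) :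
    sphericalKernel t x = sphericalKernel t x' := by
  have key : Submodule.reflection (ℝ ∙ (x - x'))ᗮ x = x' := Submodule.reflection_sub h
  set f := Submodule.reflection (ℝ ∙ (x - x'))ᗮ
  have hb : f ⁻¹' Metric.ball (0 : F) 1 = Metric.ball (0 : F) 1 := by
    ext y; simp
  have := f.measurePreserving.setIntegral_preimage_emb f.toHomeomorph.measurableEmbedding
    (fun y => Complex.exp ((inner ℝ x' (t • ‖y‖⁻¹ • y) : ℝ) * Complex.I)) (Metric.ball (0 : F) 1)
  rw [hb] at this
  rw [sphericalKernel, sphericalKernel, ← this]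
  simp only [← key, LinearIsometryEquiv.norm_map, ← map_smul, LinearIsometryEquiv.inner_map_map]

/-- After Fubini the inner integral is `charFun Q` at a vector of norm `‖ξ‖`, which does not depend
on the direction. -/
lemma integral_sphericalKernel [Nontrivial F] {Q : Measure F} [IsFiniteMeasure Q]
    (hQ : ∀ f : F ≃ₗᵢ[ℝ] F, Q.map f = Q) (ξ : F) :
    ∫ x, sphericalKernel ‖ξ‖ x ∂Q = volume.real (Metric.ball (0 : F) 1) • charFun Q ξ := by
  have : IsFiniteMeasure (volume.restrict (Metric.ball (0 : F) 1)) :=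
    ⟨by simpa using measure_ball_lt_top⟩
  unfold sphericalKernel
  rw [integral_integral_swap (f := fun (x : F) (y : F) =>
    Complex.exp ((inner ℝ x (‖ξ‖ • ‖y‖⁻¹ • y) : ℝ) * Complex.I)) (integrable_prod_character ‖ξ‖)]
  rw [← setIntegral_const]
  refine integral_congr_ae ?_
  -- At `y = 0` the normalized vector is `0` instead of a unit vector.
  have h0 : ∀ᵐ y ∂(volume.restrict (Metric.ball (0 : F) 1)), y ≠ 0 :=
    ae_restrict_of_ae (by simp [ae_iff])
  filter_upwards [h0] with y hy
  rw [← charFun_apply]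
  exact charFun_eq_of_norm_eq hQ (by simp [norm_smul, hy])

/-- A finite measure which is invariant under isometries is determined by the law of the norm. -/
lemma eq_of_map_norm_eq [Nontrivial F] {Q Q' : Measure F} [IsFiniteMeasure Q] [IsFiniteMeasure Q']
    (hQ : ∀ f : F ≃ₗᵢ[ℝ] F, Q.map f = Q) (hQ' : ∀ f : F ≃ₗᵢ[ℝ] F, Q'.map f = Q')
    (h : Q.map (fun x => ‖x‖) = Q'.map (fun x => ‖x‖)) : Q = Q' := by
  refine Measure.ext_of_charFun (funext fun ξ => ?_)
  have hv : volume.real (Metric.ball (0 : F) 1) ≠ 0 :=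
    (ENNReal.toReal_pos (Metric.measure_ball_pos _ _ one_pos).ne' measure_ball_lt_top.ne).ne'
  refine smul_right_injective ℂ hv ?_
  simp only
  rw [← integral_sphericalKernel hQ, ← integral_sphericalKernel hQ']
  obtain ⟨e, he⟩ := exists_norm_eq F zero_le_one
  -- The kernel is a function of `‖x‖` alone, so its integral sees only the law of the norm.
  have hk : ∀ x : F, sphericalKernel ‖ξ‖ x = sphericalKernel ‖ξ‖ (‖x‖ • e) := fun x =>
    sphericalKernel_eq_of_norm_eq _ (by simp [norm_smul, he])
  have hm : StronglyMeasurable fun r : ℝ => sphericalKernel ‖ξ‖ (r • e) :=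
    (stronglyMeasurable_sphericalKernel ‖ξ‖).comp_measurable (by fun_prop)
  rw [integral_congr_ae (Eventually.of_forall hk), integral_congr_ae (Eventually.of_forall hk)]
  rw [← integral_map (f := fun r : ℝ => sphericalKernel ‖ξ‖ (r • e)) (by fun_prop)
      hm.aestronglyMeasurable, h, integral_map (by fun_prop) hm.aestronglyMeasurable]

lemma map_withDensity_comp {X Y : Type*} [MeasurableSpace X] [MeasurableSpace Y] (μ : Measure X)
    {f : X → Y} (hf : Measurable f) {g : Y → ENNReal} (hg : Measurable g) :
    (μ.withDensity (g ∘ f)).map f = (μ.map f).withDensity g := by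
  ext s hs
  rw [Measure.map_apply hf hs, withDensity_apply _ (hf hs), withDensity_apply _ hs,
    setLIntegral_map hs hg hf]
  rfl

/-- An isometry-invariant measure whose norm has density `fR` on `(0, ∞)` has a density that is a
constant multiple of `fR r / r ^ (d - 1)`, `r = ‖x‖`, where `d` is the dimension. -/
lemma exists_eq_withDensity_norm [Nontrivial F] {Q : Measure F} [IsFiniteMeasure Q]
    (hQ : ∀ f : F ≃ₗᵢ[ℝ] F, Q.map f = Q) {fR : ℝ → ℝ} (hm : Measurable fR)
    (h : Q.map (fun z => ‖z‖) =
      (volume.restrict (Ioi (0 : ℝ))).withDensity (fun r => ENNReal.ofReal (fR r))) :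
    ∃ c : ℝ, 0 < c ∧ Q = volume.withDensity
      (fun x : F => ENNReal.ofReal (c * (fR ‖x‖ / ‖x‖ ^ (Module.finrank ℝ F - 1)))) := by
  set κ := (volume : Measure F).toSphere univ
  have hκ0 : κ ≠ 0 := by
    simp only [κ, Measure.toSphere_apply_univ]
    exact mul_ne_zero (by exact_mod_cast Module.finrank_pos.ne')
      (Metric.measure_ball_pos _ _ one_pos).ne'
  have hκt : κ ≠ ⊤ := measure_ne_top _ _
  have hc : 0 < κ.toReal⁻¹ := inv_pos.2 (ENNReal.toReal_pos hκ0 hκt)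
  refine ⟨κ.toReal⁻¹, hc, ?_⟩
  set g : ℝ → ENNReal := fun r =>
    ENNReal.ofReal (κ.toReal⁻¹ * (fR r / r ^ (Module.finrank ℝ F - 1))) with hg
  have hgm : Measurable g := by fun_prop
  change Q = volume.withDensity (g ∘ fun x : F => ‖x‖)
  have hmap : (volume.withDensity (g ∘ fun x : F => ‖x‖)).map (fun x => ‖x‖) =
      Q.map (fun x => ‖x‖) := by
    rw [h]
    refine Measure.ext fun s hs => ?_
    rw [Measure.map_apply (by fun_prop) hs, withDensity_apply _ (by measurability),
      withDensity_apply _ hs, ← lintegral_indicator (by measurability),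
      ← lintegral_indicator hs]
    have := lintegral_fun_norm_addHaar (volume : Measure F) (hgm.indicator hs)
    have e : ∀ x : F, ((fun x : F => ‖x‖) ⁻¹' s).indicator (g ∘ fun x : F => ‖x‖) x =
        s.indicator g ‖x‖ := fun x => rfl
    simp_rw [e]
    rw [this, ← lintegral_const_mul _ (by fun_prop)]
    refine setLIntegral_congr_fun measurableSet_Ioi fun r (hr : 0 < r) => ?_
    by_cases hrs : r ∈ s
    · simp only [indicator_of_mem hrs, hg]
      have : κ = ENNReal.ofReal κ.toReal := (ENNReal.ofReal_toReal hκt).symm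
      rw [← ENNReal.ofReal_mul (by positivity)]
      change κ * _ = _
      rw [this, ← ENNReal.ofReal_mul (by positivity), ENNReal.toReal_ofReal (by positivity)]
      congr 1
      have := inv_pos.1 hc
      field_simp
    · simp [indicator_of_notMem hrs]
  -- The candidate has the same norm law as `Q`, hence the same total mass.
  have hfin : IsFiniteMeasure (volume.withDensity (g ∘ fun x : F => ‖x‖)) := by
    have hu := congrArg (fun m : Measure ℝ => m univ) hmap
    simp only [Measure.map_apply (measurable_norm : Measurable fun x : F => ‖x‖)
      MeasurableSet.univ, preimage_univ] at hu
    exact ⟨hu ▸ measure_lt_top _ _⟩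
  refine eq_of_map_norm_eq hQ (fun f => ?_) hmap.symm
  have hcomp : (g ∘ fun x : F => ‖x‖) = (g ∘ fun x : F => ‖x‖) ∘ f := by ext; simp
  conv_lhs => rw [hcomp]
  rw [map_withDensity_comp _ f.continuous.measurable (by fun_prop), f.measurePreserving.map_eq]

/-- The law of `T Z` when `Z` has density `w`. -/
lemma exists_map_withDensity (T : F ≃L[ℝ] F) {w : F → ℝ} (hw : Measurable w) :
    ∃ c : ℝ, 0 < c ∧ (volume.withDensity (fun x => ENNReal.ofReal (w x))).map T =
      volume.withDensity (fun x => ENNReal.ofReal (c * w (T.symm x))) := by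
  have hdet : LinearMap.det (T : F →ₗ[ℝ] F) ≠ 0 := T.toLinearEquiv.isUnit_det'.ne_zero
  refine ⟨|(LinearMap.det (T : F →ₗ[ℝ] F))⁻¹|, by positivity, ?_⟩
  have hcomp : (fun x => ENNReal.ofReal (w x)) = (fun x => ENNReal.ofReal (w (T.symm x))) ∘ T := by
    ext; simp
  rw [hcomp, map_withDensity_comp _ (by fun_prop) (by fun_prop)]
  have := Measure.map_linearMap_addHaar_eq_smul_addHaar (volume : Measure F) hdet
  change Measure.map T volume = _ at this
  rw [this, withDensity_smul_measure, ← withDensity_smul _ (by fun_prop)]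
  congr 1
  ext x
  simp [ENNReal.ofReal_mul]

end Radial

/-! ### The integrand as a function of `t = ‖v‖²`, with `R = ‖x‖²` and `C = ⟪x, u⟫²` -/

section RealInequalities

variable {R C : ℝ}

/-- For `0 ≤ C ≤ R` the square root of this quantity is the length of the plane vector `(t + R - 2C,
2√(C(R - C)))`, which is affine in `t`. Convexity and the Lipschitz bound come from this. -/
lemma quad_eq (R C t : ℝ) :
    (R + t) ^ 2 - 4 * t * C = (t + (R - 2 * C)) ^ 2 + 4 * C * (R - C) := by ring

lemma quad_nonneg (hC : 0 ≤ C) (hCR : C ≤ R) (t : ℝ) : 0 ≤ (R + t) ^ 2 - 4 * t * C := by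
  rw [quad_eq]
  have := mul_nonneg hC (sub_nonneg.2 hCR)
  nlinarith [sq_nonneg (t + (R - 2 * C))]

lemma abs_add_le_sqrt_quad (hC : 0 ≤ C) (hCR : C ≤ R) (t : ℝ) :
    |t + (R - 2 * C)| ≤ √((R + t) ^ 2 - 4 * t * C) := by
  refine Real.abs_le_sqrt ?_
  have := mul_nonneg hC (sub_nonneg.2 hCR)
  rw [quad_eq]
  linarith

lemma sqrt_quad_midpoint_le (hC : 0 ≤ C) (hCR : C ≤ R) (s t : ℝ) :
    √((R + (s + t) / 2) ^ 2 - 4 * ((s + t) / 2) * C) ≤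
      (√((R + s) ^ 2 - 4 * s * C) + √((R + t) ^ 2 - 4 * t * C)) / 2 := by
  have hs := Real.sq_sqrt (quad_nonneg hC hCR s)
  have ht := Real.sq_sqrt (quad_nonneg hC hCR t)
  have hD := mul_nonneg hC (sub_nonneg.2 hCR)
  -- Cauchy–Schwarz for the two plane vectors at `s` and `t`.
  have hst : (s + (R - 2 * C)) * (t + (R - 2 * C)) + 4 * C * (R - C) ≤
      √((R + s) ^ 2 - 4 * s * C) * √((R + t) ^ 2 - 4 * t * C) := by
    rw [← Real.sqrt_mul (quad_nonneg hC hCR s)]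
    refine Real.le_sqrt_of_sq_le ?_
    nlinarith [mul_nonneg hD (sq_nonneg (s - t))]
  refine Real.sqrt_le_iff.2 ⟨by positivity, ?_⟩
  nlinarith

lemma abs_sqrt_quad_sub_le (hC : 0 ≤ C) (hCR : C ≤ R) (s t : ℝ) :
    |√((R + s) ^ 2 - 4 * s * C) - √((R + t) ^ 2 - 4 * t * C)| ≤ |s - t| := by
  have key : ∀ s t : ℝ, √((R + s) ^ 2 - 4 * s * C) ≤ √((R + t) ^ 2 - 4 * t * C) + |s - t| := by
    intro s t
    have ht := Real.sq_sqrt (quad_nonneg hC hCR t)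
    have hb := abs_add_le_sqrt_quad hC hCR t
    have hm : (s - t) * (t + (R - 2 * C)) ≤ |s - t| * √((R + t) ^ 2 - 4 * t * C) := by
      calc _ ≤ |(s - t) * (t + (R - 2 * C))| := le_abs_self _
        _ = |s - t| * |t + (R - 2 * C)| := abs_mul _ _
        _ ≤ _ := by gcongr
    refine Real.sqrt_le_iff.2 ⟨by positivity, ?_⟩
    have := sq_abs (s - t)
    nlinarith
  rw [abs_le]
  constructor
  · have := key t s
    rw [abs_sub_comm] at this
    linarith
  · linarith [key s t]

lemma sqrt_quad_zero (hR : 0 ≤ R) (C : ℝ) : √((R + 0) ^ 2 - 4 * 0 * C) = R := by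
  simp [Real.sqrt_sq hR]

lemma abs_sqrt_quad_sub_self_le (hC : 0 ≤ C) (hCR : C ≤ R) (t : ℝ) :
    |√((R + t) ^ 2 - 4 * t * C) - R| ≤ |t| := by
  have := abs_sqrt_quad_sub_le hC hCR t 0
  rwa [sqrt_quad_zero (hC.trans hCR), sub_zero] at this

/-- A convex function lies above its tangent line at `0`. -/
lemma mul_le_sqrt_quad_sub (hC : 0 ≤ C) (hCR : C ≤ R) (hR : 0 < R) (t : ℝ) :
    t * (1 - 2 * (C / R)) ≤ √((R + t) ^ 2 - 4 * t * C) - R := by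
  have h1 : 0 ≤ C / R := by positivity
  have h2 : C / R ≤ 1 := (div_le_one hR).2 hCR
  have h3 : C = C / R * R := by field_simp
  set q := C / R
  rw [h3]
  suffices R + t * (1 - 2 * q) ≤ √((R + t) ^ 2 - 4 * t * (q * R)) by linarith
  refine Real.le_sqrt_of_sq_le ?_
  nlinarith [mul_nonneg (mul_nonneg h1 (sub_nonneg.2 h2)) (sq_nonneg t)]

lemma tendsto_sqrt_quad_zero (hC : 0 ≤ C) (hCR : C ≤ R) (hR : 0 < R) :
    Tendsto (fun t => (√((R + t) ^ 2 - 4 * t * C) - R) / t) (𝓝[>] 0) (𝓝 (1 - 2 * (C / R))) := by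
  -- The difference quotient, rationalized by the conjugate `√(…) + R`, extends continuously to `t =
  -- 0`.
  have hc : ContinuousAt
      (fun t : ℝ => (t + 2 * (R - 2 * C)) / (√((R + t) ^ 2 - 4 * t * C) + R)) 0 := by
    refine ContinuousAt.div (by fun_prop) (by fun_prop) ?_
    positivity
  have h := hc.tendsto.mono_left (nhdsWithin_le_nhds (s := Ioi 0))
  rw [sqrt_quad_zero hR.le] at h
  have e : (0 + 2 * (R - 2 * C)) / (R + R) = 1 - 2 * (C / R) := by field_simp; ring
  rw [e] at h
  refine h.congr' ?_
  filter_upwards [self_mem_nhdsWithin] with t (ht : 0 < t)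
  have hs := Real.sq_sqrt (quad_nonneg hC hCR t)
  have hp : 0 < √((R + t) ^ 2 - 4 * t * C) + R := by positivity
  rw [div_eq_div_iff hp.ne' ht.ne']
  nlinarith

lemma tendsto_sqrt_quad_atTop (hC : 0 ≤ C) (hCR : C ≤ R) :
    Tendsto (fun t => (√((R + t) ^ 2 - 4 * t * C) - R) / t) atTop (𝓝 1) := by
  have h : Tendsto (fun t : ℝ => 1 - 2 * C / t) atTop (𝓝 (1 - 0)) :=
    tendsto_const_nhds.sub (tendsto_const_nhds.div_atTop tendsto_id)
  rw [sub_zero] at h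
  refine tendsto_of_tendsto_of_tendsto_of_le_of_le' h tendsto_const_nhds ?_ ?_
  · filter_upwards [eventually_gt_atTop 0] with t ht
    rw [le_div_iff₀ ht, sub_mul, div_mul_cancel₀ _ ht.ne']
    linarith [(le_abs_self _).trans (abs_add_le_sqrt_quad hC hCR t)]
  · filter_upwards [eventually_gt_atTop 0] with t ht
    rw [div_le_one ht]
    have := (le_abs_self _).trans (abs_sqrt_quad_sub_self_le hC hCR t)
    rwa [abs_of_pos ht] at this

end RealInequalities

/-! ### The objective along rays, and comparison of directions -/

section Objective

variable {p : ℕ} {P : Measure (E p)}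

lemma norm_sub_mul_norm_add (x v : E p) :
    ‖x - v‖ * ‖x + v‖ = √((‖x‖ ^ 2 + ‖v‖ ^ 2) ^ 2 - 4 * (inner ℝ x v) ^ 2) := by
  have h1 := norm_sub_sq_real x v
  have h2 := norm_add_sq_real x v
  rw [← Real.sqrt_sq (by positivity : 0 ≤ ‖x - v‖ * ‖x + v‖), mul_pow, h1, h2]
  ring_nf

/-- The objective function along the ray spanned by a unit vector `u`, as a function of the squared
norm. -/
noncomputable def profile (P : Measure (E p)) (u : E p) (t : ℝ) : ℝ :=
  ∫ x, (√((‖x‖ ^ 2 + t) ^ 2 - 4 * t * (inner ℝ x u) ^ 2) - ‖x‖ ^ 2) ∂P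

lemma inner_sq_le {u : E p} (hu : ‖u‖ = 1) (x : E p) : (inner ℝ x u) ^ 2 ≤ ‖x‖ ^ 2 := by
  rw [sq_le_sq, abs_norm]
  simpa [hu] using abs_real_inner_le_norm x u

lemma objective_sqrt_smul {u : E p} (hu : ‖u‖ = 1) {t : ℝ} (ht : 0 ≤ t) :
    objective P (√t • u) = profile P u t := by
  unfold objective profile
  congr 1 with x
  rw [norm_sub_mul_norm_add, norm_smul, hu, inner_smul_right, mul_one, mul_pow,
    Real.norm_of_nonneg (Real.sqrt_nonneg t), Real.sq_sqrt ht, mul_assoc]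

lemma objective_smul {u : E p} (hu : ‖u‖ = 1) (s : ℝ) :
    objective P (s • u) = profile P u (s ^ 2) := by
  rw [← objective_sqrt_smul hu (sq_nonneg s), Real.sqrt_sq_eq_abs]
  rcases abs_choice s with h | h <;> rw [h]
  unfold objective
  simp only [neg_smul, sub_neg_eq_add, ← sub_eq_add_neg, mul_comm]

lemma integrable_profile [IsProbabilityMeasure P] {u : E p} (hu : ‖u‖ = 1) (t : ℝ) :
    Integrable
      (fun x : E p => √((‖x‖ ^ 2 + t) ^ 2 - 4 * t * (inner ℝ x u) ^ 2) - ‖x‖ ^ 2) P :=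
  Integrable.of_bound (C := |t|) (Continuous.aestronglyMeasurable (by fun_prop)) <|
    Eventually.of_forall fun x => abs_sqrt_quad_sub_self_le (sq_nonneg _) (inner_sq_le hu x) t

lemma profile_zero (u : E p) : profile P u 0 = 0 := by
  simp [profile]

lemma continuous_profile [IsProbabilityMeasure P] {u : E p} (hu : ‖u‖ = 1) :
    Continuous (profile P u) := by
  refine LipschitzWith.continuous (K := 1) (LipschitzWith.of_dist_le_mul fun s t => ?_)
  rw [Real.dist_eq, profile, profile, ← integral_sub (integrable_profile hu s)
    (integrable_profile hu t)]
  have h : ∀ x : E p, ‖√((‖x‖ ^ 2 + s) ^ 2 - 4 * s * (inner ℝ x u) ^ 2) - ‖x‖ ^ 2 -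
      (√((‖x‖ ^ 2 + t) ^ 2 - 4 * t * (inner ℝ x u) ^ 2) - ‖x‖ ^ 2)‖ ≤ |s - t| := fun x => by
    rw [sub_sub_sub_cancel_right]
    exact abs_sqrt_quad_sub_le (sq_nonneg _) (inner_sq_le hu x) s t
  simpa [Real.dist_eq] using norm_integral_le_of_norm_le_const (μ := P) (Eventually.of_forall h)

/-- Dominated convergence: the integrand is 1-Lipschitz in `t` and vanishes at `0`, so the quotients
are bounded by `1`. -/
lemma tendsto_profile_div_of_ae [IsProbabilityMeasure P] {u : E p} (hu : ‖u‖ = 1)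
    {l : Filter ℝ} [l.IsCountablyGenerated] {G : E p → ℝ}
    (h : ∀ᵐ x ∂P, Tendsto
      (fun t => (√((‖x‖ ^ 2 + t) ^ 2 - 4 * t * (inner ℝ x u) ^ 2) - ‖x‖ ^ 2) / t) l (𝓝 (G x))) :
    Tendsto (fun t => profile P u t / t) l (𝓝 (∫ x, G x ∂P)) := by
  unfold profile
  simp_rw [← integral_div]
  refine tendsto_integral_filter_of_dominated_convergence (fun _ => 1) ?_ ?_ (by simp) h
  · exact Eventually.of_forall fun t => ((integrable_profile hu t).div_const t).1
  · refine Eventually.of_forall fun t => Eventually.of_forall fun x => ?_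
    rw [norm_div]
    exact div_le_one_of_le₀ (abs_sqrt_quad_sub_self_le (sq_nonneg _) (inner_sq_le hu x) t)
      (norm_nonneg _)

lemma tendsto_profile_div_atTop [IsProbabilityMeasure P] {u : E p} (hu : ‖u‖ = 1) :
    Tendsto (fun t => profile P u t / t) atTop (𝓝 1) := by
  simpa using tendsto_profile_div_of_ae (P := P) hu (l := atTop) (G := fun _ => 1)
    (Eventually.of_forall fun x => tendsto_sqrt_quad_atTop (sq_nonneg _) (inner_sq_le hu x))

lemma integrable_inner_sq_div [IsProbabilityMeasure P] {u : E p} (hu : ‖u‖ = 1) :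
    Integrable (fun x : E p => inner ℝ x u ^ 2 / ‖x‖ ^ 2) P := by
  refine Integrable.of_bound (C := 1) (Measurable.aestronglyMeasurable (by fun_prop)) <|
    Eventually.of_forall fun x => ?_
  rw [Real.norm_of_nonneg (by positivity)]
  exact div_le_one_of_le₀ (inner_sq_le hu x) (by positivity)

lemma tendsto_profile_div_zero [IsProbabilityMeasure P] (h0 : ∀ᵐ x ∂P, x ≠ 0) {u : E p}
    (hu : ‖u‖ = 1) :
    Tendsto (fun t => profile P u t / t) (𝓝[>] 0)
      (𝓝 (1 - 2 * ∫ x, inner ℝ x u ^ 2 / ‖x‖ ^ 2 ∂P)) := by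
  have h := tendsto_profile_div_of_ae (P := P) hu (l := 𝓝[>] 0)
    (G := fun x => 1 - 2 * (inner ℝ x u ^ 2 / ‖x‖ ^ 2)) <| by
      filter_upwards [h0] with x hx
      exact tendsto_sqrt_quad_zero (sq_nonneg _) (inner_sq_le hu x) (by positivity)
  rw [integral_sub (integrable_const _) ((integrable_inner_sq_div hu).const_mul 2),
    integral_const_mul] at h
  simpa using h

lemma mul_le_profile [IsProbabilityMeasure P] (h0 : ∀ᵐ x ∂P, x ≠ 0) {u : E p}
    (hu : ‖u‖ = 1) (t : ℝ) :
    t * (1 - 2 * ∫ x, inner ℝ x u ^ 2 / ‖x‖ ^ 2 ∂P) ≤ profile P u t := by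
  have e : t * (1 - 2 * ∫ x, inner ℝ x u ^ 2 / ‖x‖ ^ 2 ∂P) =
      ∫ x, t * (1 - 2 * (inner ℝ x u ^ 2 / ‖x‖ ^ 2)) ∂P := by
    rw [integral_const_mul, integral_sub (integrable_const _)
      ((integrable_inner_sq_div hu).const_mul 2), integral_const_mul]
    simp
  rw [e]
  refine integral_mono_ae (((integrable_const _).sub
    ((integrable_inner_sq_div hu).const_mul 2)).const_mul t) (integrable_profile hu t) ?_
  filter_upwards [h0] with x hx
  exact mul_le_sqrt_quad_sub (sq_nonneg _) (inner_sq_le hu x) (by positivity) t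

lemma integral_pos_of_isOpen {X : Type*} [TopologicalSpace X] [MeasurableSpace X]
    {μ : Measure X} [μ.IsOpenPosMeasure] {f : X → ℝ} (hf : Integrable f μ) (h0 : ∀ x, 0 ≤ f x)
    {U : Set X} (hU : IsOpen U) (hne : U.Nonempty) (hpos : ∀ x ∈ U, 0 < f x) :
    0 < ∫ x, f x ∂μ := by
  rw [integral_pos_iff_support_of_nonneg h0 hf]
  exact (hU.measure_pos μ hne).trans_le (measure_mono fun x hx => (hpos x hx).ne')

/-- Each integrand is only convex; one point of strict convexity suffices, since strictness persists
on an open set and `P` charges it. -/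
lemma profile_midpoint_lt [IsProbabilityMeasure P] [P.IsOpenPosMeasure] {u : E p}
    (hu : ‖u‖ = 1) {s t : ℝ} (hs : 0 ≤ s) (hst : s < t) :
    profile P u ((s + t) / 2) < (profile P u s + profile P u t) / 2 := by
  set q : ℝ → E p → ℝ := fun t x => √((‖x‖ ^ 2 + t) ^ 2 - 4 * t * (inner ℝ x u) ^ 2) - ‖x‖ ^ 2
    with hq
  have hqi : ∀ t, Integrable (q t) P := fun t => integrable_profile hu t
  have hqc : ∀ t, Continuous (q t) := fun t => by simp only [hq]; fun_prop
  set D : E p → ℝ := fun x => (q s x + q t x) / 2 - q ((s + t) / 2) x with hD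
  have hDc : Continuous D := by simp only [hD]; fun_prop
  have hDi : Integrable D P := (((hqi s).add (hqi t)).div_const 2).sub (hqi _)
  have key : 0 < ∫ x, D x ∂P := by
    refine integral_pos_of_isOpen hDi (fun x => ?_) (isOpen_lt continuous_const hDc)
      -- At this point `R = C = (s + t) / 2`, so the square root becomes an absolute value with its
      -- kink exactly at the midpoint.
      ⟨√((s + t) / 2) • u, ?_⟩ fun x hx => hx
    · have := sqrt_quad_midpoint_le (sq_nonneg _) (inner_sq_le hu x) s t
      simp only [hD, hq]
      linarith
    · have hm : 0 ≤ (s + t) / 2 := by linarith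
      have e : ∀ r, q r (√((s + t) / 2) • u) = |(s + t) / 2 - r| - (s + t) / 2 := fun r => by
        simp only [hq, norm_smul, inner_smul_left, real_inner_self_eq_norm_sq, hu]
        rw [Real.norm_of_nonneg (Real.sqrt_nonneg _)]
        simp only [mul_one, one_pow, conj_trivial, Real.sq_sqrt hm]
        rw [← Real.sqrt_sq_eq_abs]
        ring_nf
      simp only [mem_ofPred_eq, hD, e]
      rw [abs_of_pos (by linarith), abs_of_neg (by linarith), sub_self, abs_zero]
      linarith
  simp only [hD] at key
  have hi : Integrable (fun x => (q s x + q t x) / 2) P := ((hqi s).add (hqi t)).div_const 2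
  rw [integral_sub hi (hqi _), integral_div, integral_add (hqi s) (hqi t)] at key
  unfold profile
  linarith

/-- A law with a density that is, on every sphere, strictly larger closer to the line `ℝ o`. -/
structure IsConcentratedAlong (P : Measure (E p)) (o : E p) (w : E p → ℝ) : Prop where
  measurable : Measurable w
  pos : ∀ x, x ≠ 0 → 0 < w x
  eq_withDensity : P = volume.withDensity fun x => ENNReal.ofReal (w x)
  norm_eq_one : ‖o‖ = 1
  lt : ∀ x y, ‖x‖ = ‖y‖ → |inner ℝ x o| < |inner ℝ y o| → w x < w y

lemma IsConcentratedAlong.ae_pos [NeZero p] {o : E p} {w : E p → ℝ}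
    (h : IsConcentratedAlong P o w) : ∀ᵐ x, 0 < w x := by
  filter_upwards [Measure.ae_ne volume 0] with x hx using h.pos x hx

lemma IsConcentratedAlong.isOpenPosMeasure [NeZero p] {o : E p} {w : E p → ℝ}
    (h : IsConcentratedAlong P o w) : P.IsOpenPosMeasure := by
  refine Measure.AbsolutelyContinuous.isOpenPosMeasure (μ := volume) ?_
  rw [h.eq_withDensity]
  refine withDensity_absolutelyContinuous' h.measurable.ennreal_ofReal.aemeasurable ?_
  filter_upwards [h.ae_pos] with x hx
  simpa using hx

lemma IsConcentratedAlong.ae_ne_zero [NeZero p] {o : E p} {w : E p → ℝ}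
    (h : IsConcentratedAlong P o w) : ∀ᵐ x ∂P, x ≠ 0 := by
  rw [h.eq_withDensity]
  exact (withDensity_absolutelyContinuous _ _).ae_le (Measure.ae_ne volume 0)

/-- Among the vectors of a given norm the objective is smallest along `o`. -/
lemma IsConcentratedAlong.objective_lt [NeZero p] [IsProbabilityMeasure P] {o : E p} {w : E p → ℝ}
    (h : IsConcentratedAlong P o w) {v : E p} (h1 : v ≠ ‖v‖ • o) (h2 : v ≠ -(‖v‖ • o)) :
    objective P (‖v‖ • o) < objective P v := by
  have hs : 0 < ‖v‖ := by
    rw [norm_pos_iff]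
    rintro rfl
    simp at h1
  set a := ‖v‖ • o with ha
  have han : ‖v‖ = ‖a‖ := by simp [ha, norm_smul, h.norm_eq_one]
  -- The reflection in the hyperplane orthogonal to `v - a` exchanges `v` and `a`, as they have
  -- equal norm.
  have hfv : Submodule.reflection (ℝ ∙ (v - a))ᗮ v = a := Submodule.reflection_sub han
  have hff : ∀ x, Submodule.reflection (ℝ ∙ (v - a))ᗮ (Submodule.reflection (ℝ ∙ (v - a))ᗮ x) = x :=
    Submodule.reflection_reflection _
  set f := Submodule.reflection (ℝ ∙ (v - a))ᗮ
  have hfa : f a = v := by rw [← hfv, hff]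
  have hin : ∀ x y, inner ℝ (f x) y = inner ℝ x (f y) := fun x y => by
    rw [← f.inner_map_map, hff]
  set H : E p → E p → ℝ := fun u x => ‖x - u‖ * ‖x + u‖ - ‖x‖ ^ 2 with hH
  have hHi : ∀ u, Integrable (H u) P := fun u => integrable_objective_integrand P u
  have hHf : ∀ u x, H u (f x) = H (f u) x := fun u x => by
    have e1 : ‖f x - u‖ = ‖x - f u‖ := by rw [← f.norm_map (x - f u), map_sub, hff]
    have e2 : ‖f x + u‖ = ‖x + f u‖ := by rw [← f.norm_map (x + f u), map_add, hff]
    simp only [hH, e1, e2, f.norm_map]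
  set D : E p → ℝ := fun x => H v x - H a x with hD
  have hDf : ∀ x, D (f x) = -D x := fun x => by simp [hD, hHf, hfv, hfa]
  have hDi : Integrable D P := (hHi v).sub (hHi a)
  have hwm := h.measurable.ennreal_ofReal
  have hDw : Integrable (fun x => w x * D x) := by
    have := hDi
    rw [h.eq_withDensity, integrable_withDensity_iff_integrable_smul' hwm (by simp)] at this
    refine this.congr ?_
    filter_upwards [h.ae_pos] with x hx
    simp [hx.le]
  have hDint : ∫ x, D x ∂P = ∫ x, w x * D x := by
    rw [h.eq_withDensity, integral_withDensity_eq_integral_toReal_smul hwm (by simp)]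
    refine integral_congr_ae ?_
    filter_upwards [h.ae_pos] with x hx
    simp [hx.le]
  have hDwf : Integrable (fun x => w (f x) * D (f x)) :=
    f.measurePreserving.integrable_comp_of_integrable hDw
  have hDintf : ∫ x, w (f x) * D (f x) = ∫ x, w x * D x :=
    f.measurePreserving.integral_comp f.toHomeomorph.measurableEmbedding fun x => w x * D x
  -- For a fixed `‖v‖` the integrand decreases strictly in `⟪x, v⟫²`.
  have hA : ∀ x, |inner ℝ x v| < |inner ℝ x a| → 0 < D x := fun x hx => by
    have : (inner ℝ x v) ^ 2 < (inner ℝ x a) ^ 2 := sq_lt_sq.2 hx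
    simp only [hD, hH, norm_sub_mul_norm_add, ← han, sub_sub_sub_cancel_right, sub_pos]
    refine Real.sqrt_lt_sqrt ?_ (by linarith)
    have := abs_real_inner_le_norm x a
    rw [← han] at this
    have h3 : inner ℝ x a ^ 2 ≤ (‖x‖ * ‖v‖) ^ 2 := by
      rw [← sq_abs]; gcongr
    nlinarith [sq_nonneg (‖x‖ ^ 2 - ‖v‖ ^ 2)]
  have hw : ∀ x, |inner ℝ x v| < |inner ℝ x a| → w (f x) < w x := fun x hx => by
    refine h.lt _ _ (f.norm_map x) ?_
    have e1 : inner ℝ x a = ‖v‖ * inner ℝ x o := by rw [ha, inner_smul_right]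
    have e2 : inner ℝ x v = ‖v‖ * inner ℝ (f x) o := by
      have := hin x a
      rwa [hfa, ha, inner_smul_right, eq_comm] at this
    rw [e1, e2, abs_mul, abs_mul] at hx
    exact lt_of_mul_lt_mul_left hx (abs_nonneg _)
  have hprod : ∀ x, |inner ℝ x v| < |inner ℝ x a| → 0 < (w x - w (f x)) * D x := fun x hx =>
    mul_pos (sub_pos.2 (hw x hx)) (hA x hx)
  have hnn : ∀ x, 0 ≤ (w x - w (f x)) * D x := fun x => by
    rcases lt_trichotomy |inner ℝ x v| |inner ℝ x a| with hx | hx | hx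
    · exact (hprod x hx).le
    · have : (inner ℝ x v) ^ 2 = (inner ℝ x a) ^ 2 := sq_eq_sq_iff_abs_eq_abs _ _ |>.2 hx
      have hD0 : D x = 0 := by
        simp only [hD, hH, norm_sub_mul_norm_add, ← han, this, sub_self]
      simp [hD0]
    · have := hprod (f x) (by rwa [hin, hin, hfv, hfa])
      rw [hff, hDf] at this
      linarith
  -- Both terms on the right have the same integral, so the left side integrates to twice the gap
  -- between the objectives.
  have e : (fun x => (w x - w (f x)) * D x) = fun x => w x * D x + w (f x) * D (f x) := by
    ext x; rw [hDf]; ring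
  have hi : Integrable (fun x => (w x - w (f x)) * D x) := by
    rw [e]; exact hDw.add hDwf
  have hpos : 0 < ∫ x, (w x - w (f x)) * D x := by
    -- The set contains `a`: Cauchy–Schwarz for `v` and `a` is strict because `v ≠ ±a`.
    refine integral_pos_of_isOpen hi hnn
      (U := {x | |inner ℝ x v| < |inner ℝ x a|}) (isOpen_lt (by fun_prop) (by fun_prop))
      ⟨a, ?_⟩ hprod
    have n1 : 0 < ‖v - a‖ ^ 2 := by
      have := norm_pos_iff.2 (sub_ne_zero.2 h1); positivity
    have n2 : 0 < ‖v + a‖ ^ 2 := by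
      have := norm_pos_iff.2 (fun h0 => h2 (eq_neg_of_add_eq_zero_left h0)); positivity
    rw [norm_sub_sq_real, ← han] at n1
    rw [norm_add_sq_real, ← han] at n2
    simp only [mem_ofPred_eq, real_inner_self_eq_norm_sq, ← han]
    rw [abs_of_nonneg (sq_nonneg ‖v‖), abs_lt, real_inner_comm]
    constructor <;> linarith
  rw [e, integral_add hDw hDwf, hDintf, ← hDint, hD, integral_sub (hHi v) (hHi a)] at hpos
  change ∫ x, H a x ∂P < ∫ x, H v x ∂P
  linarith

end Objective

/-! ### Minimizers on the line `ℝ o` -/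

section Minimizers

variable {p : ℕ} [NeZero p] {P : Measure (E p)} [IsProbabilityMeasure P] {o : E p} {w : E p → ℝ}

lemma IsConcentratedAlong.objective_le (h : IsConcentratedAlong P o w) (v : E p) :
    objective P (‖v‖ • o) ≤ objective P v := by
  by_cases h1 : v = ‖v‖ • o
  · rw [← h1]
  by_cases h2 : v = -(‖v‖ • o)
  · refine le_of_eq ?_
    conv_rhs => rw [h2, ← neg_smul, objective_smul h.norm_eq_one, neg_sq]
    rw [objective_smul h.norm_eq_one]
  · exact (h.objective_lt h1 h2).le

lemma IsConcentratedAlong.minimizers_objective (h : IsConcentratedAlong P o w) {t : ℝ} (ht : 0 ≤ t)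
    (hmin : ∀ s, 0 ≤ s → s ≠ t → profile P o t < profile P o s) :
    minimizers (objective P) = {√t • o, -(√t • o)} := by
  have hneg : -(√t • o) = (-√t) • o := (neg_smul _ _).symm
  have hle : ∀ v, profile P o t ≤ objective P v ∧
      (objective P v = profile P o t → v = √t • o ∨ v = -(√t • o)) := by
    intro v
    have hv : profile P o t ≤ objective P (‖v‖ • o) := by
      rw [objective_smul h.norm_eq_one]
      rcases eq_or_ne (‖v‖ ^ 2) t with e | e
      · rw [e]
      · exact (hmin _ (sq_nonneg _) e).le
    refine ⟨hv.trans (h.objective_le v), fun e => ?_⟩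
    by_cases hvo : v = ‖v‖ • o ∨ v = -(‖v‖ • o)
    · have hov : objective P v = profile P o (‖v‖ ^ 2) := by
        rcases hvo with e | e
        · conv_lhs => rw [e, objective_smul h.norm_eq_one]
        · conv_lhs => rw [e, ← neg_smul, objective_smul h.norm_eq_one, neg_sq]
      have : ‖v‖ ^ 2 = t := by
        by_contra hne
        have := hmin _ (sq_nonneg _) hne
        linarith
      rwa [← Real.sqrt_sq (norm_nonneg v), this] at hvo
    · push Not at hvo
      linarith [h.objective_lt hvo.1 hvo.2]
  have hatt : objective P (√t • o) = profile P o t := objective_sqrt_smul h.norm_eq_one ht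
  have hatt' : objective P (-(√t • o)) = profile P o t := by
    rw [hneg, objective_smul h.norm_eq_one, neg_sq, Real.sq_sqrt ht]
  ext v
  simp only [minimizers, mem_ofPred_eq, mem_insert_iff, mem_singleton_iff]
  constructor
  · intro hv
    exact (hle v).2 (le_antisymm (hatt ▸ hv _) (hle v).1)
  · rintro (rfl | rfl) z
    · rw [hatt]; exact (hle z).1
    · rw [hatt']; exact (hle z).1

lemma IsConcentratedAlong.minimizers_of_le_half (h : IsConcentratedAlong P o w)
    (hq : ∫ x, inner ℝ x o ^ 2 / ‖x‖ ^ 2 ∂P ≤ 1 / 2) : minimizers (objective P) = {0} := by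
  have := h.isOpenPosMeasure
  have hnn : ∀ t, 0 ≤ t → 0 ≤ profile P o t := fun t ht =>
    (mul_nonneg ht (by linarith)).trans (mul_le_profile h.ae_ne_zero h.norm_eq_one t)
  rw [h.minimizers_objective le_rfl fun s hs hs0 => ?_]
  · simp
  -- The profile is nonnegative at `s / 2` and strictly below half its value at `s`, so the latter
  -- is positive.
  · have hm := profile_midpoint_lt (P := P) h.norm_eq_one le_rfl (lt_of_le_of_ne hs hs0.symm)
    have := hnn ((0 + s) / 2) (by linarith)
    rw [profile_zero] at hm ⊢
    linarith

/-- The negative slope at `0` makes the profile along `u` negative for a small `t`; at equal norm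
the objective along `o` is no larger. -/
lemma IsConcentratedAlong.exists_profile_neg (h : IsConcentratedAlong P o w) {u : E p}
    (hu : ‖u‖ = 1) (hq : 1 / 2 < ∫ x, inner ℝ x u ^ 2 / ‖x‖ ^ 2 ∂P) :
    ∃ t, 0 < t ∧ profile P o t < 0 := by
  have hlim := tendsto_profile_div_zero (P := P) h.ae_ne_zero hu
  obtain ⟨t, ht, ht0⟩ :=
    ((hlim.eventually (gt_mem_nhds (by linarith : _ < (0 : ℝ)))).and self_mem_nhdsWithin).exists
  replace ht0 : 0 < t := ht0
  refine ⟨t, ht0, ?_⟩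
  have hneg : profile P u t < 0 := by
    rwa [div_lt_iff₀ ht0, zero_mul] at ht
  rw [← objective_sqrt_smul hu ht0.le] at hneg
  have hn : ‖√t • u‖ = √t := by rw [norm_smul, hu, mul_one, Real.norm_of_nonneg (Real.sqrt_nonneg t)]
  refine lt_of_le_of_lt ?_ hneg
  have := h.objective_le (√t • u)
  rwa [hn, objective_sqrt_smul h.norm_eq_one ht0.le] at this

lemma IsConcentratedAlong.minimizers_of_half_lt (h : IsConcentratedAlong P o w) {u : E p}
    (hu : ‖u‖ = 1) (hq : 1 / 2 < ∫ x, inner ℝ x u ^ 2 / ‖x‖ ^ 2 ∂P) :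
    ∃ ψ : ℝ, 0 < ψ ∧ minimizers (objective P) = {ψ • o, -(ψ • o)} := by
  have := h.isOpenPosMeasure
  obtain ⟨t₀, ht₀, hneg⟩ := h.exists_profile_neg hu hq
  have hev := (tendsto_profile_div_atTop (P := P) h.norm_eq_one).eventually
    (lt_mem_nhds (zero_lt_one' ℝ))
  obtain ⟨T, hT⟩ := (hev.and (eventually_gt_atTop 0)).exists_forall_of_atTop
  have hTpos : ∀ t, T ≤ t → 0 < profile P o t := fun t ht => by
    have := hT t ht
    simpa [div_mul_cancel₀ _ this.2.ne'] using mul_pos this.1 this.2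
  -- The profile is positive from `T` on, so its minimum over `[0, T]`, being negative, is global.
  have ht₀T : t₀ ≤ T := le_of_not_gt fun hlt => by linarith [hTpos t₀ hlt.le]
  obtain ⟨t, htm, htmin⟩ := isCompact_Icc.exists_isMinOn (s := Icc 0 T) ⟨t₀, ht₀.le, ht₀T⟩
    (continuous_profile (P := P) h.norm_eq_one).continuousOn
  have htneg : profile P o t < 0 := (htmin ⟨ht₀.le, ht₀T⟩).trans_lt hneg
  have hmin : ∀ s, 0 ≤ s → profile P o t ≤ profile P o s := fun s hs => by
    rcases le_total s T with hsT | hsT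
    · exact htmin ⟨hs, hsT⟩
    · linarith [hTpos s hsT]
  have htpos : 0 < t := lt_of_le_of_ne htm.1 fun e => by
    rw [← e, profile_zero] at htneg
    exact htneg.false
  refine ⟨√t, Real.sqrt_pos.2 htpos, h.minimizers_objective htpos.le fun s hs hst => ?_⟩
  refine lt_of_le_of_ne (hmin s hs) fun e => ?_
  -- Two distinct minimizers would give a strictly smaller value at their midpoint.
  have hmid := hmin ((s + t) / 2) (by linarith)
  rcases lt_or_gt_of_ne hst with hlt | hlt
  · have := profile_midpoint_lt (P := P) h.norm_eq_one hs hlt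
    linarith
  · have := profile_midpoint_lt (P := P) h.norm_eq_one htpos.le hlt
    rw [add_comm t s] at this
    linarith

end Minimizers

/-! ### Quadratic form and leading eigenvalue of the spatial sign covariance -/

section SignCovariance

variable {p : ℕ} {P : Measure (E p)}

lemma integral_inner_sq_div [IsProbabilityMeasure P] (u : E p) :
    ∫ x, inner ℝ x u ^ 2 / ‖x‖ ^ 2 ∂P = u.ofLp ⬝ᵥ (signCov P).mulVec u.ofLp := by
  have hi : ∀ i j : Fin p, Integrable (fun x : E p => x i * x j / ‖x‖ ^ 2) P := fun i j => by
    refine Integrable.of_bound (C := 1) (Measurable.aestronglyMeasurable (by fun_prop)) <|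
      Eventually.of_forall fun x => ?_
    rw [norm_div, norm_mul, norm_pow, norm_norm]
    refine div_le_one_of_le₀ ?_ (by positivity)
    rw [sq]
    exact mul_le_mul (PiLp.norm_apply_le x i) (PiLp.norm_apply_le x j) (norm_nonneg _)
      (norm_nonneg _)
  have e : ∀ x : E p, inner ℝ x u ^ 2 / ‖x‖ ^ 2 =
      ∑ i, ∑ j, u i * u j * (x i * x j / ‖x‖ ^ 2) := fun x => by
    rw [PiLp.inner_apply, sq, Finset.sum_mul_sum, Finset.sum_div]
    refine Finset.sum_congr rfl fun i _ => ?_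
    rw [Finset.sum_div]
    refine Finset.sum_congr rfl fun j _ => ?_
    simp only [RCLike.inner_apply, conj_trivial]
    ring
  simp_rw [e]
  rw [integral_finsetSum _ fun i _ => integrable_finsetSum _ fun j _ => (hi i j).const_mul _]
  simp only [dotProduct, Matrix.mulVec, signCov, Matrix.of_apply, Finset.mul_sum]
  refine Finset.sum_congr rfl fun i _ => ?_
  rw [integral_finsetSum _ fun j _ => (hi i j).const_mul _]
  refine Finset.sum_congr rfl fun j _ => ?_
  rw [integral_const_mul]
  ring

lemma dotProduct_self_ofLp (u : E p) : u.ofLp ⬝ᵥ u.ofLp = ‖u‖ ^ 2 := by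
  rw [EuclideanSpace.real_norm_sq_eq]
  simp [dotProduct, sq]

lemma dotProduct_mulVec_le_leadingEigenvalue [NeZero p] {A : Matrix (Fin p) (Fin p) ℝ}
    (hA : A.IsHermitian) {u : E p} (hu : ‖u‖ = 1) :
    u.ofLp ⬝ᵥ A.mulVec u.ofLp ≤ leadingEigenvalue A := by
  -- The spectrum of this difference is `leadingEigenvalue A` minus the spectrum of `A`, hence
  -- nonnegative.
  have hps : (leadingEigenvalue A • (1 : Matrix (Fin p) (Fin p) ℝ) - A).PosSemidef := by
    rw [Matrix.posSemidef_iff_isHermitian_and_spectrum_nonneg]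
    refine ⟨(Matrix.isHermitian_one.smul (IsSelfAdjoint.all _)).sub hA, fun a ha => ?_⟩
    rw [← Algebra.algebraMap_eq_smul_one, ← spectrum.singleton_sub_eq] at ha
    obtain ⟨b, hb, c, hc, rfl⟩ := ha
    rw [mem_singleton_iff.1 hb]
    exact sub_nonneg.2 ((isGreatest_leadingEigenvalue hA).2 hc)
  have := hps.dotProduct_mulVec_nonneg u.ofLp
  rw [Matrix.sub_mulVec, Matrix.smul_mulVec, Matrix.one_mulVec, dotProduct_sub, dotProduct_smul,
    star_trivial, dotProduct_self_ofLp, hu] at this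
  simpa using this

lemma exists_dotProduct_mulVec_eq_leadingEigenvalue [NeZero p] {A : Matrix (Fin p) (Fin p) ℝ}
    (hA : A.IsHermitian) :
    ∃ u : E p, ‖u‖ = 1 ∧ u.ofLp ⬝ᵥ A.mulVec u.ofLp = leadingEigenvalue A := by
  have h := (isGreatest_leadingEigenvalue hA).1
  rw [hA.spectrum_real_eq_range_eigenvalues] at h
  obtain ⟨i, hi⟩ := h
  have hn : ‖hA.eigenvectorBasis i‖ = 1 := hA.eigenvectorBasis.norm_eq_one i
  refine ⟨hA.eigenvectorBasis i, hn, ?_⟩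
  rw [hA.mulVec_eigenvectorBasis, dotProduct_smul, dotProduct_self_ofLp, hn, hi]
  simp

end SignCovariance

/-! ### Elliptical laws are concentrated along the first column -/

section Family

variable {p : ℕ}

lemma IsSpherical.map_linearIsometryEquiv {Q : Measure (E p)} (hQ : IsSpherical Q)
    (f : E p ≃ₗᵢ[ℝ] E p) : Q.map f = Q := by
  set A : Matrix (Fin p) (Fin p) ℝ :=
    (Matrix.toEuclideanCLM (n := Fin p) (𝕜 := ℝ)).symm (f : E p →L[ℝ] E p)
  have hAf : Matrix.toEuclideanCLM (n := Fin p) (𝕜 := ℝ) A = (f : E p →L[ℝ] E p) :=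
    StarAlgEquiv.apply_symm_apply _ _
  have hA : A ∈ Matrix.orthogonalGroup (Fin p) ℝ := by
    refine Matrix.mem_unitaryGroup_iff'.2 ?_
    apply EquivLike.injective (Matrix.toEuclideanCLM (n := Fin p) (𝕜 := ℝ))
    rw [map_mul, map_star, hAf, map_one]
    exact Unitary.star_mul_self_of_mem (Unitary.linearIsometryEquiv.symm f).2
  have hact : act A = f := by
    ext1 x
    simp [act, hAf]
  rw [← hact]
  exact hQ A hA

lemma act_mul (A B : Matrix (Fin p) (Fin p) ℝ) (x : E p) : act (A * B) x = act A (act B x) := by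
  simp [act]

lemma inner_act_act {O : Matrix (Fin p) (Fin p) ℝ} (hO : O ∈ Matrix.orthogonalGroup (Fin p) ℝ)
    (x y : E p) : inner ℝ (act O x) (act O y) = inner ℝ x y :=
  Unitary.inner_map_map
    ⟨_, Unitary.map_mem (Matrix.toEuclideanCLM (n := Fin p) (𝕜 := ℝ)) hO⟩ x y

variable [NeZero p]

lemma firstColumn_eq_act (O : Matrix (Fin p) (Fin p) ℝ) :
    firstColumn O = act O (EuclideanSpace.single 0 1) := by
  ext i
  simp [firstColumn, act_apply]

lemma act_smul_diagonal (s l : ℝ) (z : E p) :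
    act (s • Matrix.diagonal (fun i : Fin p => if i = 0 then l else 1)) z =
      s • (z + ((l - 1) * z 0) • EuclideanSpace.single 0 1) := by
  ext i
  simp only [act_apply, Matrix.smul_apply, Matrix.diagonal_apply, smul_eq_mul, PiLp.smul_apply,
    PiLp.add_apply, PiLp.single_apply]
  rw [Finset.sum_eq_single i (by intro j _ hj; simp [hj.symm]) (by simp)]
  by_cases hi : i = 0
  · subst hi; simp; ring
  · simp [hi]

lemma inner_act_firstColumn {O : Matrix (Fin p) (Fin p) ℝ}
    (hO : O ∈ Matrix.orthogonalGroup (Fin p) ℝ) (s l : ℝ) (z : E p) :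
    inner ℝ (act (O * s • Matrix.diagonal (fun i : Fin p => if i = 0 then l else 1)) z)
      (firstColumn O) = s * l * z 0 := by
  rw [act_mul, firstColumn_eq_act, inner_act_act hO, act_smul_diagonal]
  simp [inner_smul_left, inner_add_left, EuclideanSpace.inner_single_right]
  ring

lemma norm_sq_act {O : Matrix (Fin p) (Fin p) ℝ}
    (hO : O ∈ Matrix.orthogonalGroup (Fin p) ℝ) (s l : ℝ) (z : E p) :
    ‖act (O * s • Matrix.diagonal (fun i : Fin p => if i = 0 then l else 1)) z‖ ^ 2 =
      s ^ 2 * (‖z‖ ^ 2 + (l ^ 2 - 1) * z 0 ^ 2) := by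
  rw [act_mul, ← real_inner_self_eq_norm_sq, inner_act_act hO, act_smul_diagonal,
    real_inner_self_eq_norm_sq, norm_smul, mul_pow, norm_add_sq_real, norm_smul]
  simp [inner_smul_right, EuclideanSpace.inner_single_right, mul_pow]
  ring_nf
  simp

lemma exists_isConcentratedAlong {O L : Matrix (Fin p) (Fin p) ℝ}
    (hO : O ∈ Matrix.orthogonalGroup (Fin p) ℝ) (hL : L ∈ D1 p) {P : Measure (E p)}
    (hP : P ∈ ellipticalFamily O L) :
    IsProbabilityMeasure P ∧ ∃ w, IsConcentratedAlong P (firstColumn O) w := by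
  obtain ⟨Q, hQ, rfl⟩ := hP
  obtain ⟨s, l, hs, hl, rfl⟩ := hL
  have hQp := hQ.isProbabilityMeasure
  set M := O * s • Matrix.diagonal (fun i : Fin p => if i = 0 then l else 1) with hM
  have hnorm : ∀ z, ‖act M z‖ ^ 2 = s ^ 2 * (‖z‖ ^ 2 + (l ^ 2 - 1) * z 0 ^ 2) :=
    norm_sq_act hO s l
  have hl2 : 0 < l ^ 2 - 1 := by nlinarith
  -- The norm formula gives `‖act M z‖² ≥ s² ‖z‖²`.
  have hinj : Function.Injective (Matrix.toEuclideanCLM (n := Fin p) (𝕜 := ℝ) M).toLinearMap := by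
    rw [injective_iff_map_eq_zero]
    intro z hz
    have h0 : act M z = 0 := hz
    have := hnorm z
    rw [h0, norm_zero, zero_pow two_ne_zero, eq_comm, mul_eq_zero] at this
    have h2 := this.resolve_left (by positivity)
    have h3 : 0 ≤ (l ^ 2 - 1) * z 0 ^ 2 := by positivity
    have h4 : ‖z‖ ^ 2 = 0 := by nlinarith [sq_nonneg ‖z‖]
    simpa using h4
  set T : E p ≃L[ℝ] E p :=
    (LinearEquiv.ofInjectiveEndo _ hinj).toContinuousLinearEquiv with hT
  have hTact : ∀ z, T z = act M z := fun z => rfl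
  have hTfun : act M = T := rfl
  refine ⟨Measure.isProbabilityMeasure_map (hTfun ▸ T.continuous.aemeasurable), ?_⟩
  obtain ⟨fR, hfm, hfpos, hfmap, hanti⟩ := hQ.exists_density
  obtain ⟨c, hc, hQd⟩ := exists_eq_withDensity_norm hQ.isSpherical.map_linearIsometryEquiv hfm hfmap
  rw [finrank_euclideanSpace_fin] at hQd
  obtain ⟨c', hc', hPd⟩ := exists_map_withDensity T
    (w := fun x : E p => c * (fR ‖x‖ / ‖x‖ ^ (p - 1))) (by fun_prop)
  rw [← hQd] at hPd
  refine ⟨fun x => c' * (c * (fR ‖T.symm x‖ / ‖T.symm x‖ ^ (p - 1))), by fun_prop, fun x hx => ?_,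
    by rw [hTfun, hPd], ?_, fun x y hxy hlt => ?_⟩
  · have hx' : 0 < ‖T.symm x‖ := norm_pos_iff.2 (by simpa using hx)
    have := hfpos _ hx'
    positivity
  · have : ‖firstColumn O‖ ^ 2 = 1 := by
      rw [firstColumn_eq_act, ← real_inner_self_eq_norm_sq, inner_act_act hO]
      simp
    exact (pow_eq_one_iff_of_nonneg (norm_nonneg _) two_ne_zero).1 this
  · have hy : y ≠ 0 := by
      rintro rfl
      simp only [inner_zero_left, abs_zero] at hlt
      exact (abs_nonneg _).not_gt hlt
    have hx : x ≠ 0 := by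
      rw [← norm_ne_zero_iff, hxy]; exact norm_ne_zero_iff.2 hy
    have hx' : 0 < ‖T.symm x‖ := norm_pos_iff.2 (by simpa using hx)
    have hy' : 0 < ‖T.symm y‖ := norm_pos_iff.2 (by simpa using hy)
    have ex := hnorm (T.symm x)
    have ey := hnorm (T.symm y)
    have ix := inner_act_firstColumn hO s l (T.symm x)
    have iy := inner_act_firstColumn hO s l (T.symm y)
    rw [← hM, ← hTact, T.apply_symm_apply] at ix iy
    rw [← hTact, T.apply_symm_apply] at ex ey
    rw [ix, iy, abs_mul, abs_mul _ (T.symm y 0)] at hlt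
    have h0 := sq_lt_sq.2 (lt_of_mul_lt_mul_left hlt (abs_nonneg _))
    -- With this sum fixed and `l > 1`, the preimage with the larger first coordinate in absolute
    -- value has the smaller norm, where the decreasing radial profile is larger.
    have hsum : ‖T.symm x‖ ^ 2 + (l ^ 2 - 1) * T.symm x 0 ^ 2 =
        ‖T.symm y‖ ^ 2 + (l ^ 2 - 1) * T.symm y 0 ^ 2 :=
      mul_left_cancel₀ (by positivity : s ^ 2 ≠ 0) (by rw [← ex, ← ey, hxy])
    have hlt' : ‖T.symm y‖ < ‖T.symm x‖ := by
      refine lt_of_pow_lt_pow_left₀ 2 (norm_nonneg _) ?_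
      nlinarith
    have := hanti (mem_Ioi.2 hy') (mem_Ioi.2 hx') hlt'
    gcongr

end Family

end EllipticalPCA

theorem mainTheorem1 {p : ℕ} [NeZero p] (O L : Matrix (Fin p) (Fin p) ℝ)
    (hO : O ∈ Matrix.orthogonalGroup (Fin p) ℝ) (hL : L ∈ EllipticalPCA.D1 p)
    (P : MeasureTheory.Measure (EllipticalPCA.E p))
    (hP : P ∈ EllipticalPCA.ellipticalFamily O L) :
    (1 / 2 < EllipticalPCA.leadingEigenvalue (EllipticalPCA.signCov P) →
      ∃ ψ : ℝ, 0 < ψ ∧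
        EllipticalPCA.minimizers (EllipticalPCA.objective P) =
          {ψ • EllipticalPCA.firstColumn O, -(ψ • EllipticalPCA.firstColumn O)}) ∧
    (EllipticalPCA.leadingEigenvalue (EllipticalPCA.signCov P) ≤ 1 / 2 →
      EllipticalPCA.minimizers (EllipticalPCA.objective P) = {0}) := by
  obtain ⟨hprob, w, h⟩ := EllipticalPCA.exists_isConcentratedAlong hO hL hP
  have hS := EllipticalPCA.signCov_isHermitian P
  constructor
  · intro hlt
    obtain ⟨u, hu, hqu⟩ := EllipticalPCA.exists_dotProduct_mulVec_eq_leadingEigenvalue hS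
    rw [← hqu, ← EllipticalPCA.integral_inner_sq_div] at hlt
    exact h.minimizers_of_half_lt hu hlt
  · intro hle
    refine h.minimizers_of_le_half ?_
    rw [EllipticalPCA.integral_inner_sq_div]
    exact (EllipticalPCA.dotProduct_mulVec_le_leadingEigenvalue hS h.norm_eq_one).trans hle
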